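/- Let $N\ge 1$. A partially ordered Soules basis of $\mathbb{R}^N$ is an orthonormal basis $v_1,\dots,v_N$ of $\mathbb{R}^N$, with $v_1$ entrywise positive, together with a partial order $\ge_{\mathcal P}$ on the set $\{v_n\}$ for which $v_1\ge_{\mathcal P} v_n$ for all $n$, such that $\sum_n\lambda_n v_nv_n^T$ has nonnegative off-diagonal entries for all real $\lambda_1,\dots,\lambda_N$ satisfying $v_n\ge_{\mathcal P}v_m\Rightarrow\lambda_n\ge\lambda_m$ (in particular $\lambda_1\ge\lambda_n$ for all $n$). Let $\mathcal T$ be a finite binary rooted tree, i.e. a finite simple directed graph in which each node has no or exactly two outgoing links, all links point away from a root $\rho$ from which every node can be reached, and there is at most one directed path between any pair of nodes. Suppose that $\mathcal T$ has $N$ leaf nodes (nodes without outgoing links), identified with $1,\dots,N$. Write $n\ge_{\mathcal T}m$ if there is a (possibly trivial) directed path from $n$ to $m$. For each non-leaf node $n$ call the two nodes it points to $m^+$ and $m^-$, in either order, and let $\mathcal V^{\pm}(n)$ be the set of leaf nodes $k$ with $m^{\pm}\ge_{\mathcal T}k$, and $\mathcal V(n)=\mathcal V^+(n)\cup\mathcal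 V^-(n)$. For an entrywise positive vector $x\in\mathbb{R}^N$ let $\Vert x_{\mathcal V}\Vert^2=\sum_{i\in\mathcal V}x_i^2$, and define the Soules vectors by $$r_1=\frac{x}{\Vert x\Vert},\qquad (r_n)_i=\begin{cases}\dfrac{+x_i}{\Vert x_{\mathcal V(n)}\Vert}\dfrac{\Vert x_{\mathcal V^-(n)}\Vert}{\Vert x_{\mathcal V^+(n)}\Vert}& i\in\mathcal V^+(n),\\[2mm] \dfrac{-x_i}{\Vert x_{\mathcal V(n)}\Vert}\dfrac{\Vert x_{\mathcal V^+(n)}\Vert}{\Vert x_{\mathcal V^-(n)}\Vert}& i\in\mathcal V^-(n),\\ 0&\text{otherwise,}\end{cases}\qquad n\text{ a non-leaf node.}\tag{1}$$ Then the Soules vectors, ordered by $r_n\ge r_m\Leftrightarrow n\ge_{\mathcal T}m$ for non-leaf nodes $n,m$ and with $r_1$ preceding all vectors, form a partially ordered Soules basis of $\mathbb{R}^N$. Conversely, every partially ordered Soules basis $(\{v_n\},\ge_{\mathcal P})$ of $\mathbb{R}^N$ arises from a binary rooted tree by the construction (1): there are a finite binary rooted tree $\mathcal T$ with $N$ leaf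 nodes identified with $1,\dots,N$, a choice of $m^{\pm}$ for each non-leaf node, and an entrywise positive $x\in\mathbb{R}^N$ such that $v_1=r_1$, the other vectors $v_n$ are exactly the vectors $r_n$ of the non-leaf nodes (each occurring once), and the order $\ge_{\mathcal P}$ is consistent with the tree: $n\ge_{\mathcal T}m\Rightarrow r_n\ge_{\mathcal P}r_m$ for all non-leaf nodes $n,m$. -/

import Mathlib

open scoped Classical in
/-- `‖x_S‖`, the Euclidean norm of the restriction of the vector `x` to the set `S` of entries. -/
noncomputable def normOn {N : ℕ} (x : EuclideanSpace ℝ (Fin N)) (S : Set (Fin N)) : ℝ :=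
  Real.sqrt (∑ i, if i ∈ S then x i ^ 2 else 0)

/-- The list `l` of nodes is a directed path from `a` to `b` along the links `Link`. The one-element
list `[a]` is the trivial path from `a` to itself. Nodes may be repeated, so that a graph with a
directed cycle through `a` has several paths from `a` to `a`. -/
def IsDirectedPath {V : Type*} (Link : V → V → Prop) (a b : V) (l : List V) : Prop :=
  l.head? = some a ∧ l.getLast? = some b ∧ l.IsChain Link

/-- A binary rooted tree with node set `V`; `Link n m` is a link directed from `n` to `m`.
Since every node can be reached from the root, the graph is weakly connected. -/
structure BinaryRootedTree (V : Type*) where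
  /-- the directed links -/
  Link : V → V → Prop
  /-- the root node -/
  root : V
  /-- the directed graph is simple -/
  loopless : ∀ n, ¬ Link n n
  /-- each node has either no or exactly two outgoing links -/
  binary : ∀ n, (∀ m, ¬ Link n m) ∨ ∃ p q, p ≠ q ∧ ∀ k, Link n k ↔ k = p ∨ k = q
  /-- all links point away from the root: every node is the end of a directed path from it -/
  rooted : ∀ n, ∃ l, IsDirectedPath Link root n l
  /-- there is at most one directed path between any pair of nodes -/
  path_unique : ∀ a b l l', IsDirectedPath Link a b l → IsDirectedPath Link a b l' → l = l'

namespace BinaryRootedTree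

variable {V : Type*} (T : BinaryRootedTree V)

/-- The tree order on the nodes: `n ≥ m` iff there is a directed path from `n` to `m`. -/
def Ge (n m : V) : Prop := ∃ l, IsDirectedPath T.Link n m l

/-- A leaf node has no outgoing links. -/
def IsLeaf (n : V) : Prop := ∀ m, ¬ T.Link n m

/-- The type of leaf nodes. -/
abbrev Leaf : Type _ := {n : V // T.IsLeaf n}

/-- The type of non-leaf nodes. -/
abbrev NonLeaf : Type _ := {n : V // ¬ T.IsLeaf n}

noncomputable instance instFintypeNonLeaf [Finite V] : Fintype T.NonLeaf := Fintype.ofFinite _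

/-- A choice, for every non-leaf node `n`, which of the two nodes that `n` points to
is `m⁺` and which is `m⁻`. -/
structure ChildSigns where
  /-- the node `m⁺` -/
  pos : T.NonLeaf → V
  /-- the node `m⁻` -/
  neg : T.NonLeaf → V
  pos_ne_neg : ∀ n, pos n ≠ neg n
  link_iff : ∀ (n : T.NonLeaf) (k : V), T.Link n k ↔ k = pos n ∨ k = neg n

variable {T} {N : ℕ}

/-- The leaf descendants `𝒱⁺(n)`, as a set of entries; the bijection `e` identifies the
leaf nodes with the entries of vectors. -/
def leafPos (σ : T.ChildSigns) (e : T.Leaf ≃ Fin N) (n : T.NonLeaf) : Set (Fin N) :=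
  {i | T.Ge (σ.pos n) (e.symm i)}

/-- The leaf descendants `𝒱⁻(n)`. -/
def leafNeg (σ : T.ChildSigns) (e : T.Leaf ≃ Fin N) (n : T.NonLeaf) : Set (Fin N) :=
  {i | T.Ge (σ.neg n) (e.symm i)}

/-- The leaf descendants `𝒱(n) = 𝒱⁺(n) ∪ 𝒱⁻(n)`. -/
def leafDesc (σ : T.ChildSigns) (e : T.Leaf ≃ Fin N) (n : T.NonLeaf) : Set (Fin N) :=
  leafPos σ e n ∪ leafNeg σ e n

open scoped Classical in
/-- The Soules vectors. The index `none` stands for the vector `r₁ = x / ‖x‖`, the index `some n`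
for the vector `rₙ` of the non-leaf node `n`. -/
noncomputable def soulesVector (σ : T.ChildSigns) (e : T.Leaf ≃ Fin N)
    (x : EuclideanSpace ℝ (Fin N)) : Option T.NonLeaf → EuclideanSpace ℝ (Fin N)
  | none => ‖x‖⁻¹ • x
  | some n => WithLp.toLp 2 fun i =>
      if i ∈ leafPos σ e n then
        x i / normOn x (leafDesc σ e n) * (normOn x (leafNeg σ e n) / normOn x (leafPos σ e n))
      else if i ∈ leafNeg σ e n then
        -x i / normOn x (leafDesc σ e n) * (normOn x (leafPos σ e n) / normOn x (leafNeg σ e n))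
      else 0

variable (T)

/-- The order on the Soules vectors: `r₁` precedes all vectors, and the vectors of the non-leaf
nodes are ordered by the tree order. -/
def SoulesGe : Option T.NonLeaf → Option T.NonLeaf → Prop
  | none, _ => True
  | some _, none => False
  | some n, some m => T.Ge n m

end BinaryRootedTree

/-- The vectors `v n`, ordered by the relation `ge`, form a partially ordered Soules basis of `ℝ^N`
with `one` as the index of the positive vector `v₁`. -/
structure IsPartiallyOrderedSoulesBasis {N : ℕ} {ι : Type*} [Fintype ι]
    (v : ι → EuclideanSpace ℝ (Fin N)) (ge : ι → ι → Prop) (one : ι) : Prop where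
  /-- `ge` is a partial order -/
  ge_refl : ∀ n, ge n n
  ge_antisymm : ∀ n m, ge n m → ge m n → n = m
  ge_trans : ∀ n m k, ge n m → ge m k → ge n k
  /-- `v₁` precedes all other vectors -/
  one_ge : ∀ n, ge one n
  /-- the vectors form an orthonormal basis of `ℝ^N` -/
  card_eq : Fintype.card ι = N
  orthonormal : Orthonormal ℝ v
  /-- `v₁` is a positive vector -/
  one_pos : ∀ i, 0 < v one i
  /-- `∑ λₙ vₙ vₙᵀ` has nonnegative off-diagonal entries for all real `λₙ` ordered consistently
  with the vectors -/
  offDiag_nonneg : ∀ lam : ι → ℝ, (∀ n m, ge n m → lam m ≤ lam n) →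
    ∀ i j, i ≠ j → 0 ≤ (∑ n, lam n • Matrix.vecMulVec (v n) (v n)) i j

/-!
From a tree to a basis: the leaf sets of two distinct non-leaf nodes are disjoint, or one of
them is contained in the positive or in the negative leaf set of the other. As `r_n` is
orthogonal to `x`, and its ratio to `x` is constant on each sign side, the Soules vectors are orthonormal;
there are `N` of them because a binary tree has one more leaf than it has non-leaf nodes
(`BinaryRootedTree.card_option_nonLeaf`). For `i ≠ j` the products `(r_n)_i (r_n)_j` sum to zero by
completeness. The only negative one belongs to the node `n` that separates `i` from `j`, and all
other nonzero ones belong to ancestors of `n` or to `r_1`. Hence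
`∑ λ_m (r_m)_i (r_m)_j = ∑ (λ_m - λ_n) (r_m)_i (r_m)_j` has only nonnegative terms.

From a basis to a tree: for a set `U` of indices that contains that of `v_1` and is closed under
passing to larger indices, taking for `λ` the indicator function of `U` shows that the orthogonal
projection `P_U` onto the span of the `v_n`, `n ∈ U`, has nonnegative entries. Since `P_U` fixes
the positive vector `v_1`, the relation `0 < (P_U)_{ij}` is an equivalence relation, and every
vector fixed by `P_U` is a constant multiple of `v_1` on each of its classes
(`IsPartiallyOrderedSoulesBasis.div_eq_div_of_projEntry_pos`). If `U ∪ {n}` is closed too,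
comparing `P_U` with `P_{U ∪ {n}} = P_U + v_n v_nᵀ` shows that adding `n` splits the class
`supp v_n` into the two classes where `v_n` is positive and where it is negative, and leaves
the other classes alone. So
the supports and the sign sets form a binary tree with the singletons as leaves
(`IsPartiallyOrderedSoulesBasis.splitTree`), and `v_n` is a unit vector orthogonal to `v_1` with
constant ratio to `v_1` on both sign sides, which determines it
(`signStep_orthonormal_iff`). The order is the one required because a class that lies on one sign
side of `v_n` cannot arise before `v_n` has been added
(`IsPartiallyOrderedSoulesBasis.ge_of_posSet`).
-/

/-! ### Paths and the tree order -/

theorem isDirectedPath_iff {V : Type*} {Link : V → V → Prop} {a b : V} {l : List V} :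
    IsDirectedPath Link a b l ↔
      ∃ t, l = a :: t ∧ (a :: t).IsChain Link ∧ (a :: t).getLast (List.cons_ne_nil _ _) = b := by
  cases l with
  | nil => simp [IsDirectedPath]
  | cons c t =>
    simp only [IsDirectedPath, List.head?_cons, Option.some.injEq, List.cons.injEq,
      List.getLast?_eq_some_getLast (List.cons_ne_nil c t)]
    constructor
    · rintro ⟨rfl, h1, h2⟩
      exact ⟨t, ⟨rfl, rfl⟩, h2, h1⟩
    · rintro ⟨t', ⟨rfl, rfl⟩, h2, h1⟩
      exact ⟨rfl, h1, h2⟩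

theorem isDirectedPath_singleton {V : Type*} (Link : V → V → Prop) (a : V) :
    IsDirectedPath Link a a [a] := by
  simp [IsDirectedPath]

theorem IsDirectedPath.cons {V : Type*} {Link : V → V → Prop} {a b c : V} {l : List V}
    (hab : Link a b) (h : IsDirectedPath Link b c l) : IsDirectedPath Link a c (a :: l) := by
  obtain ⟨t, rfl, h1, h2⟩ := isDirectedPath_iff.1 h
  exact isDirectedPath_iff.2 ⟨_, rfl, List.IsChain.cons_cons hab h1, by
    rwa [List.getLast_cons (List.cons_ne_nil _ _)]⟩

theorem IsDirectedPath.concat {V : Type*} {Link : V → V → Prop} {a b c : V} {l : List V}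
    (h : IsDirectedPath Link a b l) (hbc : Link b c) : IsDirectedPath Link a c (l ++ [c]) := by
  obtain ⟨h1, h2, h3⟩ := h
  refine ⟨by simp [h1], by simp, ?_⟩
  refine List.IsChain.append h3 (List.IsChain.singleton c) ?_
  intro p hp q hq
  simp_all

theorem IsDirectedPath.reflTransGen {V : Type*} {Link : V → V → Prop} {a b : V} {l : List V}
    (h : IsDirectedPath Link a b l) : Relation.ReflTransGen Link a b := by
  obtain ⟨t, rfl, h1, h2⟩ := isDirectedPath_iff.1 h
  exact List.relationReflTransGen_of_exists_isChain_cons t h1 h2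

namespace BinaryRootedTree

variable {V : Type*} (T : BinaryRootedTree V)

theorem ge_iff {a b : V} : T.Ge a b ↔ Relation.ReflTransGen T.Link a b := by
  constructor
  · rintro ⟨l, h⟩
    exact h.reflTransGen
  · intro h
    induction h using Relation.ReflTransGen.head_induction_on with
    | refl => exact ⟨_, isDirectedPath_singleton _ _⟩
    | head hab _ ih =>
      obtain ⟨l, hl⟩ := ih
      exact ⟨_, hl.cons hab⟩

theorem ge_refl (a : V) : T.Ge a a := T.ge_iff.2 .refl

variable {T}

theorem Ge.trans {a b c : V} (h : T.Ge a b) (h' : T.Ge b c) : T.Ge a c :=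
  T.ge_iff.2 ((T.ge_iff.1 h).trans (T.ge_iff.1 h'))

theorem Ge.of_link {a b : V} (h : T.Link a b) : T.Ge a b := T.ge_iff.2 (.single h)

theorem Ge.exists_link {a b : V} (h : T.Ge a b) (hne : a ≠ b) : ∃ c, T.Link a c ∧ T.Ge c b := by
  rcases (T.ge_iff.1 h).cases_head with h | ⟨c, h1, h2⟩
  · exact absurd h hne
  · exact ⟨c, h1, T.ge_iff.2 h2⟩

/-- There is no directed cycle: it would be a second path from a node to itself. -/
theorem not_ge_of_link {a b : V} (h : T.Link a b) : ¬ T.Ge b a := by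
  rintro ⟨l, hl⟩
  have := T.path_unique a a _ _ (isDirectedPath_singleton _ _) (hl.cons h)
  obtain ⟨t, rfl, -⟩ := isDirectedPath_iff.1 hl
  simp at this

theorem Ge.antisymm {a b : V} (h : T.Ge a b) (h' : T.Ge b a) : a = b := by
  by_contra hne
  obtain ⟨c, h1, h2⟩ := h.exists_link hne
  exact not_ge_of_link h1 (h2.trans h')

/-- Two distinct children of a node have no common descendant. -/
theorem child_unique {a p q k : V} (hp : T.Link a p) (hq : T.Link a q) (hpk : T.Ge p k)
    (hqk : T.Ge q k) : p = q := by
  obtain ⟨l, hl⟩ := hpk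
  obtain ⟨l', hl'⟩ := hqk
  have := T.path_unique a k _ _ (hl.cons hp) (hl'.cons hq)
  obtain ⟨t, rfl, -⟩ := isDirectedPath_iff.1 hl
  obtain ⟨t', rfl, -⟩ := isDirectedPath_iff.1 hl'
  simp_all

theorem parent_unique {p q k : V} (hp : T.Link p k) (hq : T.Link q k) : p = q := by
  obtain ⟨l, hl⟩ := T.rooted p
  obtain ⟨l', hl'⟩ := T.rooted q
  have := T.path_unique _ k _ _ (hl.concat hp) (hl'.concat hq)
  have hll : l = l' := by simpa using this
  subst hll
  have := hl.2.1.symm.trans hl'.2.1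
  simpa using this

/-- The ancestors of a node form a chain. -/
theorem ge_total_of_ge {a b k : V} (ha : T.Ge a k) (hb : T.Ge b k) : T.Ge a b ∨ T.Ge b a := by
  have hU : Relator.RightUnique (Function.swap T.Link) := fun _ _ _ h h' => parent_unique h h'
  have := Relation.ReflTransGen.total_of_right_unique hU
    (Relation.reflTransGen_swap.2 (T.ge_iff.1 ha)) (Relation.reflTransGen_swap.2 (T.ge_iff.1 hb))
  rw [T.ge_iff, T.ge_iff]
  exact this.symm.imp Relation.reflTransGen_swap.1 Relation.reflTransGen_swap.1

theorem root_ge (k : V) : T.Ge T.root k := T.rooted k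

theorem exists_leaf_ge [Finite V] (a : V) : ∃ k, T.IsLeaf k ∧ T.Ge a k := by
  let r : V → V → Prop := fun b a => T.Ge a b ∧ a ≠ b
  have : IsTrans V r := ⟨fun a b c h h' => ⟨h'.1.trans h.1, fun hca => by
    subst hca
    exact h.2 (h.1.antisymm h'.1)⟩⟩
  have : Std.Irrefl r := ⟨fun a h => h.2 rfl⟩
  have hwf : WellFounded r := Finite.wellFounded_of_trans_of_irrefl r
  induction a using hwf.induction with
  | _ a ih =>
    by_cases h : T.IsLeaf a
    · exact ⟨a, h, T.ge_refl a⟩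
    · simp only [IsLeaf, not_forall, not_not] at h
      obtain ⟨c, hc⟩ := h
      obtain ⟨k, hk, hck⟩ := ih c ⟨.of_link hc, fun h => T.loopless a (h ▸ hc)⟩
      exact ⟨k, hk, (Ge.of_link hc).trans hck⟩

theorem ChildSigns.link_pos (σ : T.ChildSigns) (n : T.NonLeaf) : T.Link n (σ.pos n) :=
  (σ.link_iff n _).2 (.inl rfl)

theorem ChildSigns.link_neg (σ : T.ChildSigns) (n : T.NonLeaf) : T.Link n (σ.neg n) :=
  (σ.link_iff n _).2 (.inr rfl)

/-- Sending a non-leaf node and a sign to the child of that sign is a bijection onto the nodes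
other than the root, so a binary tree has one more leaf than it has non-leaf nodes. -/
theorem card_option_nonLeaf [Finite V] (σ : T.ChildSigns) {N : ℕ} (e : T.Leaf ≃ Fin N) :
    Fintype.card (Option T.NonLeaf) = N := by
  classical
  have := Fintype.ofFinite V
  let g : T.NonLeaf × Bool → {k : V // k ≠ T.root} := fun p =>
    ⟨if p.2 then σ.pos p.1 else σ.neg p.1, by
      have h : T.Link p.1 (if p.2 then σ.pos p.1 else σ.neg p.1) := by
        split_ifs
        exacts [σ.link_pos _, σ.link_neg _]
      intro h0
      exact not_ge_of_link h (h0 ▸ root_ge _)⟩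
  have hg : Function.Bijective g := by
    constructor
    · rintro ⟨n, s⟩ ⟨m, t⟩ h
      have h' : (if s then σ.pos n else σ.neg n) = (if t then σ.pos m else σ.neg m) :=
        congrArg Subtype.val h
      have hn : T.Link n (if s then σ.pos n else σ.neg n) := by
        split_ifs
        exacts [σ.link_pos _, σ.link_neg _]
      have hm : T.Link m (if t then σ.pos m else σ.neg m) := by
        split_ifs
        exacts [σ.link_pos _, σ.link_neg _]
      have hnm : n = m := Subtype.ext (parent_unique hn (h' ▸ hm))
      subst hnm
      have := σ.pos_ne_neg n
      cases s <;> cases t <;> simp_all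
    · rintro ⟨k, hk⟩
      rcases (T.ge_iff.1 (T.root_ge k)).cases_tail with h | ⟨p, -, hp⟩
      · exact absurd h hk
      · have hnl : ¬ T.IsLeaf p := fun h => h k hp
        rcases (σ.link_iff ⟨p, hnl⟩ k).1 hp with h | h
        · exact ⟨(⟨p, hnl⟩, true), Subtype.ext h.symm⟩
        · exact ⟨(⟨p, hnl⟩, false), Subtype.ext h.symm⟩
  have h1 := Nat.card_eq_of_bijective g hg
  have h2 : Nat.card {k : V // k ≠ T.root} = Nat.card V - 1 := by
    simp [Fintype.card_subtype_compl]
  have h3 : Nat.card T.Leaf + Nat.card T.NonLeaf = Nat.card V := by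
    rw [← Nat.card_sum]
    exact Nat.card_congr (Equiv.sumCompl _)
  have h4 : Nat.card T.Leaf = N := by simpa using Nat.card_congr e
  have h5 : 0 < Nat.card V := Nat.card_pos_iff.2 ⟨⟨T.root⟩, inferInstance⟩
  rw [Nat.card_prod, Nat.card_eq_fintype_card (α := Bool), Fintype.card_bool] at h1
  rw [Fintype.card_option, ← Nat.card_eq_fintype_card]
  omega

end BinaryRootedTree

/-! ### The vector attached to a pair of disjoint sets -/

section SplitVector

variable {N : ℕ}

theorem normOn_sq (x : EuclideanSpace ℝ (Fin N)) (S : Set (Fin N)) [DecidablePred (· ∈ S)] :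
    normOn x S ^ 2 = ∑ i, if i ∈ S then x i ^ 2 else 0 := by
  rw [normOn, Real.sq_sqrt]
  · congr!
  · exact Finset.sum_nonneg fun i _ => by split_ifs <;> positivity

theorem normOn_pos {x : EuclideanSpace ℝ (Fin N)} (hx : ∀ i, 0 < x i) {S : Set (Fin N)}
    (hS : S.Nonempty) : 0 < normOn x S := by
  classical
  obtain ⟨k, hk⟩ := hS
  have h : 0 < normOn x S ^ 2 := by
    rw [normOn_sq]
    refine Finset.sum_pos' (fun i _ => by split_ifs <;> positivity) ⟨k, Finset.mem_univ _, ?_⟩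
    simpa [hk] using pow_pos (hx k) 2
  exact (sq_pos_iff.1 h).lt_of_le' (Real.sqrt_nonneg _)

theorem normOn_union_sq (x : EuclideanSpace ℝ (Fin N)) {P Q : Set (Fin N)} (h : Disjoint P Q) :
    normOn x (P ∪ Q) ^ 2 = normOn x P ^ 2 + normOn x Q ^ 2 := by
  classical
  rw [normOn_sq, normOn_sq, normOn_sq, ← Finset.sum_add_distrib]
  refine Finset.sum_congr rfl fun i _ => ?_
  have : i ∈ P → i ∉ Q := fun hP => Set.disjoint_left.1 h hP
  by_cases h1 : i ∈ P <;> by_cases h2 : i ∈ Q <;> simp_all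

open scoped Classical in
/-- The function equal to `a` on `P`, to `-b` on `Q` and to `0` elsewhere (for disjoint `P`, `Q`):
the ratio to `x` of a Soules vector has this shape. -/
noncomputable def signStep (P Q : Set (Fin N)) (a b : ℝ) (i : Fin N) : ℝ :=
  if i ∈ P then a else if i ∈ Q then -b else 0

variable {x y : EuclideanSpace ℝ (Fin N)} {P Q : Set (Fin N)} {a b : ℝ}

theorem signStep_of_mem_left {i : Fin N} (hi : i ∈ P) : signStep P Q a b i = a := by
  simp [signStep, hi]

theorem signStep_of_mem_right (h : Disjoint P Q) {i : Fin N} (hi : i ∈ Q) :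
    signStep P Q a b i = -b := by
  simp [signStep, hi, Set.disjoint_right.1 h hi]

theorem signStep_of_notMem {i : Fin N} (hi : i ∉ P ∪ Q) : signStep P Q a b i = 0 := by
  simp_all [signStep]

theorem sum_mul_signStep (h : Disjoint P Q) (hy : ∀ i, y i = x i * signStep P Q a b i) :
    ∑ i, x i * y i = a * normOn x P ^ 2 - b * normOn x Q ^ 2 := by
  classical
  rw [normOn_sq, normOn_sq, Finset.mul_sum, Finset.mul_sum, ← Finset.sum_sub_distrib]
  refine Finset.sum_congr rfl fun i _ => ?_
  have : i ∈ P → i ∉ Q := fun hP => Set.disjoint_left.1 h hP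
  rw [hy]
  by_cases h1 : i ∈ P <;> by_cases h2 : i ∈ Q <;> simp_all [signStep] <;> ring

theorem sum_sq_signStep (h : Disjoint P Q) (hy : ∀ i, y i = x i * signStep P Q a b i) :
    ∑ i, y i ^ 2 = a ^ 2 * normOn x P ^ 2 + b ^ 2 * normOn x Q ^ 2 := by
  classical
  rw [normOn_sq, normOn_sq, Finset.mul_sum, Finset.mul_sum, ← Finset.sum_add_distrib]
  refine Finset.sum_congr rfl fun i _ => ?_
  have : i ∈ P → i ∉ Q := fun hP => Set.disjoint_left.1 h hP
  rw [hy]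
  by_cases h1 : i ∈ P <;> by_cases h2 : i ∈ Q <;> simp_all [signStep] <;> ring

/-- The value on `P`, relative to `x`, of a Soules vector with positive set `P` and negative
set `Q`. Exchanging `P` and `Q` gives the absolute value on `Q`. -/
noncomputable def soulesCoeff (x : EuclideanSpace ℝ (Fin N)) (P Q : Set (Fin N)) : ℝ :=
  normOn x Q / (normOn x (P ∪ Q) * normOn x P)

theorem soulesCoeff_pos (hx : ∀ i, 0 < x i) (hP : P.Nonempty) (hQ : Q.Nonempty) :
    0 < soulesCoeff x P Q :=
  div_pos (normOn_pos hx hQ) (mul_pos (normOn_pos hx (hP.mono Set.subset_union_left))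
    (normOn_pos hx hP))

/-- The coefficients of the Soules vectors are the only ones that make the vector a unit vector
orthogonal to `x`. -/
theorem signStep_orthonormal_iff (hx : ∀ i, 0 < x i) (hP : P.Nonempty) (hQ : Q.Nonempty)
    (h : Disjoint P Q) (ha : 0 < a) (hy : ∀ i, y i = x i * signStep P Q a b i) :
    (∑ i, x i * y i = 0 ∧ ∑ i, y i ^ 2 = 1) ↔ a = soulesCoeff x P Q ∧ b = soulesCoeff x Q P := by
  rw [sum_mul_signStep h hy, sum_sq_signStep h hy, soulesCoeff, soulesCoeff, Set.union_comm Q P]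
  have hw := normOn_union_sq x h
  have hw0 := normOn_pos hx (hP.mono (Set.subset_union_left (t := Q)))
  have hp := normOn_pos hx hP
  have hq := normOn_pos hx hQ
  set p := normOn x P
  set q := normOn x Q
  set w := normOn x (P ∪ Q)
  constructor
  · rintro ⟨h1, h2⟩
    have hb : b = a * p ^ 2 / q ^ 2 := by
      field_simp
      linarith
    have h3 : (a * (w * p)) ^ 2 = q ^ 2 := by
      rw [hb] at h2
      field_simp at h2
      rw [mul_pow, mul_pow, hw]
      linarith
    have h4 : a * (w * p) = q := (pow_left_inj₀ (by positivity) hq.le two_ne_zero).1 h3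
    have h5 : a = q / (w * p) := by
      rw [← h4]
      field_simp
    refine ⟨h5, ?_⟩
    rw [hb, h5]
    field_simp
  · rintro ⟨rfl, rfl⟩
    constructor
    · field_simp
      ring
    · field_simp
      linarith

end SplitVector

/-! ### Soules vectors of a tree -/

namespace BinaryRootedTree

variable {V : Type*} {T : BinaryRootedTree V} {N : ℕ} (σ : T.ChildSigns) (e : T.Leaf ≃ Fin N)

theorem mem_leafDesc_iff (n : T.NonLeaf) (i : Fin N) :
    i ∈ leafDesc σ e n ↔ T.Ge n (e.symm i) := by
  constructor
  · rintro (h | h)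
    · exact (Ge.of_link (σ.link_pos n)).trans h
    · exact (Ge.of_link (σ.link_neg n)).trans h
  · intro h
    have hne : (n : V) ≠ e.symm i := fun h => n.2 (h ▸ (e.symm i).2)
    obtain ⟨c, h1, h2⟩ := h.exists_link hne
    rcases (σ.link_iff n c).1 h1 with rfl | rfl
    exacts [.inl h2, .inr h2]

theorem disjoint_leafPos_leafNeg (n : T.NonLeaf) : Disjoint (leafPos σ e n) (leafNeg σ e n) :=
  Set.disjoint_left.2 fun _ h h' =>
    σ.pos_ne_neg n (child_unique (σ.link_pos n) (σ.link_neg n) h h')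

theorem leafPos_nonempty [Finite V] (n : T.NonLeaf) : (leafPos σ e n).Nonempty := by
  obtain ⟨k, hk, h⟩ := T.exists_leaf_ge (σ.pos n)
  exact ⟨e ⟨k, hk⟩, by simpa [leafPos] using h⟩

theorem leafNeg_nonempty [Finite V] (n : T.NonLeaf) : (leafNeg σ e n).Nonempty := by
  obtain ⟨k, hk, h⟩ := T.exists_leaf_ge (σ.neg n)
  exact ⟨e ⟨k, hk⟩, by simpa [leafNeg] using h⟩

theorem leafDesc_subset_of_ge {n m : T.NonLeaf} (h : T.Ge n m) (hne : n ≠ m) :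
    leafDesc σ e m ⊆ leafPos σ e n ∨ leafDesc σ e m ⊆ leafNeg σ e n := by
  obtain ⟨c, h1, h2⟩ := h.exists_link (fun h => hne (Subtype.ext h))
  rcases (σ.link_iff n c).1 h1 with rfl | rfl
  · exact .inl fun i hi => h2.trans ((mem_leafDesc_iff σ e m i).1 hi)
  · exact .inr fun i hi => h2.trans ((mem_leafDesc_iff σ e m i).1 hi)

theorem ge_total_of_mem_leafDesc {n m : T.NonLeaf} {i : Fin N} (hn : i ∈ leafDesc σ e n)
    (hm : i ∈ leafDesc σ e m) : T.Ge n m ∨ T.Ge m n :=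
  ge_total_of_ge ((mem_leafDesc_iff σ e n i).1 hn) ((mem_leafDesc_iff σ e m i).1 hm)

variable (x : EuclideanSpace ℝ (Fin N))

theorem soulesVector_some_apply (n : T.NonLeaf) (i : Fin N) :
    soulesVector σ e x (some n) i = x i * signStep (leafPos σ e n) (leafNeg σ e n)
      (soulesCoeff x (leafPos σ e n) (leafNeg σ e n))
      (soulesCoeff x (leafNeg σ e n) (leafPos σ e n)) i := by
  rw [soulesCoeff, soulesCoeff, Set.union_comm (leafNeg σ e n) (leafPos σ e n)]
  simp only [soulesVector, signStep, leafDesc]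
  split_ifs
  · ring
  · ring
  · simp

variable {x}

theorem soulesVector_some_eq_zero {n : T.NonLeaf} {i : Fin N} (h : i ∉ leafDesc σ e n) :
    soulesVector σ e x (some n) i = 0 := by
  rw [soulesVector_some_apply, signStep_of_notMem h, mul_zero]

/-- Relative to `x`, a Soules vector is constant on the leaves below any node strictly
below its own node. -/
theorem exists_soulesVector_eq_mul {n m : T.NonLeaf} (h : T.Ge n m) (hne : n ≠ m) :
    ∃ c, ∀ i ∈ leafDesc σ e m, soulesVector σ e x (some n) i = x i * c := by
  rcases leafDesc_subset_of_ge σ e h hne with h | h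
  · exact ⟨_, fun i hi => by rw [soulesVector_some_apply, signStep_of_mem_left (h hi)]⟩
  · exact ⟨_, fun i hi => by
      rw [soulesVector_some_apply, signStep_of_mem_right (disjoint_leafPos_leafNeg σ e n) (h hi)]⟩

variable [Finite V]

theorem soulesVector_some_sums (hx : ∀ i, 0 < x i) (n : T.NonLeaf) :
    ∑ i, x i * soulesVector σ e x (some n) i = 0 ∧
      ∑ i, soulesVector σ e x (some n) i ^ 2 = 1 :=
  (signStep_orthonormal_iff hx (leafPos_nonempty σ e n) (leafNeg_nonempty σ e n)
    (disjoint_leafPos_leafNeg σ e n)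
    (soulesCoeff_pos hx (leafPos_nonempty σ e n) (leafNeg_nonempty σ e n))
    (soulesVector_some_apply σ e x n)).2 ⟨rfl, rfl⟩

theorem sum_soulesVector_mul_of_ge (hx : ∀ i, 0 < x i) {n m : T.NonLeaf} (h : T.Ge n m)
    (hne : n ≠ m) :
    ∑ i, soulesVector σ e x (some n) i * soulesVector σ e x (some m) i = 0 := by
  obtain ⟨c, hc⟩ := exists_soulesVector_eq_mul σ e (x := x) h hne
  rw [← mul_zero c, ← (soulesVector_some_sums σ e hx m).1, Finset.mul_sum]
  refine Finset.sum_congr rfl fun i _ => ?_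
  by_cases hi : i ∈ leafDesc σ e m
  · rw [hc i hi]
    ring
  · rw [soulesVector_some_eq_zero σ e hi]
    ring

theorem sum_soulesVector_mul_of_ne (hx : ∀ i, 0 < x i) {n m : T.NonLeaf} (hne : n ≠ m) :
    ∑ i, soulesVector σ e x (some n) i * soulesVector σ e x (some m) i = 0 := by
  by_cases h : T.Ge n m
  · exact sum_soulesVector_mul_of_ge σ e hx h hne
  by_cases h' : T.Ge m n
  · rw [← sum_soulesVector_mul_of_ge σ e hx h' hne.symm]
    exact Finset.sum_congr rfl fun i _ => mul_comm _ _
  refine Finset.sum_eq_zero fun i _ => ?_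
  by_cases hi : i ∈ leafDesc σ e n
  · have hm : i ∉ leafDesc σ e m := fun hm =>
      (ge_total_of_mem_leafDesc σ e hi hm).elim h h'
    rw [soulesVector_some_eq_zero σ e hm, mul_zero]
  · rw [soulesVector_some_eq_zero σ e hi, zero_mul]

theorem norm_pos_of_pos (e : T.Leaf ≃ Fin N) (hx : ∀ i, 0 < x i) : 0 < ‖x‖ := by
  obtain ⟨k, hk, -⟩ := T.exists_leaf_ge T.root
  refine norm_pos_iff.2 fun h => ?_
  have := hx (e ⟨k, hk⟩)
  simp [h] at this

theorem orthonormal_soulesVector (hx : ∀ i, 0 < x i) : Orthonormal ℝ (soulesVector σ e x) := by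
  have hx0 := norm_pos_of_pos e hx
  constructor
  · rintro (_ | n)
    · simp [soulesVector, norm_smul, hx0.ne']
    · rw [EuclideanSpace.norm_eq, Real.sqrt_eq_one]
      simpa using (soulesVector_some_sums σ e hx n).2
  · rintro (_ | n) (_ | m) hne
    · exact absurd rfl hne
    · have := (soulesVector_some_sums σ e hx m).1
      rw [show soulesVector σ e x none = ‖x‖⁻¹ • x from rfl, real_inner_smul_left,
        PiLp.inner_apply]
      simp only [RCLike.inner_apply, conj_trivial]
      simp only [mul_comm (x _)] at this
      rw [this, mul_zero]
    · have := (soulesVector_some_sums σ e hx n).1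
      rw [show soulesVector σ e x none = ‖x‖⁻¹ • x from rfl, real_inner_smul_right,
        PiLp.inner_apply]
      simp only [RCLike.inner_apply, conj_trivial]
      rw [this, mul_zero]
    · rw [PiLp.inner_apply]
      simp only [RCLike.inner_apply, conj_trivial]
      exact sum_soulesVector_mul_of_ne σ e hx fun h => hne (by rw [h])

end BinaryRootedTree

/-- Completeness: the columns of a square matrix with orthonormal rows are orthogonal. -/
theorem Orthonormal.sum_mul_eq_zero {N : ℕ} {ι : Type*} [Fintype ι]
    {v : ι → EuclideanSpace ℝ (Fin N)} (hv : Orthonormal ℝ v) (hcard : Fintype.card ι = N)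
    {i j : Fin N} (hij : i ≠ j) : ∑ n, v n i * v n j = 0 := by
  classical
  have h1 : (Matrix.of fun n i => v n i) * (Matrix.of fun (n : ι) (i : Fin N) => v n i).transpose
      = 1 := by
    ext n m
    have := orthonormal_iff_ite.1 hv m n
    rw [PiLp.inner_apply] at this
    simpa [Matrix.mul_apply, Matrix.one_apply, eq_comm] using this
  have h2 := (Matrix.mul_eq_one_comm_of_card_eq _ _ _ (by simp [hcard])).1 h1
  have h3 := congrFun (congrFun h2 i) j
  simpa [Matrix.mul_apply, hij] using h3

namespace BinaryRootedTree

variable {V : Type*} {T : BinaryRootedTree V} {N : ℕ} (σ : T.ChildSigns) (e : T.Leaf ≃ Fin N)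
  {x : EuclideanSpace ℝ (Fin N)}

/-- If the node `n` separates the leaves `i` and `j`, the Soules vectors that contribute to the
entry `(i, j)` with a nonzero product belong to the nodes above `n`, and those strictly above `n`
contribute positively. -/
theorem soulesVector_mul_of_neg (hx : ∀ i, 0 < x i) {n m : T.NonLeaf} {i j : Fin N}
    (hn : soulesVector σ e x (some n) i * soulesVector σ e x (some n) j < 0) (hnm : n ≠ m) :
    soulesVector σ e x (some m) i * soulesVector σ e x (some m) j = 0 ∨
      T.Ge m n ∧ 0 ≤ soulesVector σ e x (some m) i * soulesVector σ e x (some m) j := by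
  have hpos : ∀ {n m : T.NonLeaf}, T.Ge n m → n ≠ m → i ∈ leafDesc σ e m → j ∈ leafDesc σ e m →
      0 ≤ soulesVector σ e x (some n) i * soulesVector σ e x (some n) j := by
    intro n m h hne hi hj
    obtain ⟨c, hc⟩ := exists_soulesVector_eq_mul σ e (x := x) h hne
    rw [hc i hi, hc j hj, mul_mul_mul_comm]
    exact mul_nonneg (mul_pos (hx i) (hx j)).le (mul_self_nonneg c)
  have hni : i ∈ leafDesc σ e n := by
    by_contra h
    simp [soulesVector_some_eq_zero σ e h] at hn
  have hnj : j ∈ leafDesc σ e n := by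
    by_contra h
    simp [soulesVector_some_eq_zero σ e h] at hn
  by_cases hmi : i ∈ leafDesc σ e m
  swap
  · simp [soulesVector_some_eq_zero σ e hmi]
  by_cases hmj : j ∈ leafDesc σ e m
  swap
  · simp [soulesVector_some_eq_zero σ e hmj]
  rcases ge_total_of_mem_leafDesc σ e hni hmi with h | h
  · exact absurd (hpos h hnm hmi hmj) hn.not_ge
  · exact .inr ⟨h, hpos h hnm.symm hni hnj⟩

theorem isPartiallyOrderedSoulesBasis_soulesVector [Finite V] (hx : ∀ i, 0 < x i) :
    IsPartiallyOrderedSoulesBasis (soulesVector σ e x) T.SoulesGe none where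
  ge_refl := by
    rintro (_ | n)
    exacts [trivial, T.ge_refl n]
  ge_antisymm := by
    rintro (_ | n) (_ | m) h h'
    · rfl
    · exact h'.elim
    · exact h.elim
    · exact congrArg some (Subtype.ext (Ge.antisymm h h'))
  ge_trans := by
    rintro (_ | n) (_ | m) (_ | k) h h' <;>
      first | trivial | exact h.elim | exact h'.elim | exact Ge.trans h h'
  one_ge _ := trivial
  card_eq := card_option_nonLeaf σ e
  orthonormal := orthonormal_soulesVector σ e hx
  one_pos i := by
    have := mul_pos (inv_pos.2 (norm_pos_of_pos e hx)) (hx i)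
    simpa [soulesVector] using this
  offDiag_nonneg := by
    intro lam hlam i j hij
    have h0 := (orthonormal_soulesVector σ e hx).sum_mul_eq_zero (card_option_nonLeaf σ e) hij
    have hnone : 0 < soulesVector σ e x none i * soulesVector σ e x none j := by
      have := inv_pos.2 (norm_pos_of_pos e hx)
      simpa [soulesVector] using mul_pos (mul_pos this (hx i)) (mul_pos this (hx j))
    simp only [Matrix.sum_apply, Matrix.smul_apply, Matrix.vecMulVec_apply, smul_eq_mul]
    -- The products sum to zero and the one of `r₁` is positive, so one of them is negative.
    obtain ⟨n, hn⟩ : ∃ n, soulesVector σ e x (some n) i * soulesVector σ e x (some n) j < 0 := by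
      by_contra! h
      rw [Fintype.sum_option] at h0
      exact absurd h0 (add_pos_of_pos_of_nonneg hnone (Finset.sum_nonneg fun n _ => h n)).ne'
    -- Subtracting a multiple of the vanishing sum removes the only negative term.
    have h1 : ∑ k, lam k * (soulesVector σ e x k i * soulesVector σ e x k j) =
        ∑ k, (lam k - lam (some n)) * (soulesVector σ e x k i * soulesVector σ e x k j) := by
      simp only [sub_mul, Finset.sum_sub_distrib, ← Finset.mul_sum, h0, mul_zero, sub_zero]
    rw [h1]
    refine Finset.sum_nonneg fun k _ => ?_
    rcases k with _ | m
    · exact mul_nonneg (sub_nonneg.2 (hlam _ _ trivial)) hnone.le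
    · rcases eq_or_ne n m with rfl | hnm
      · simp
      · rcases soulesVector_mul_of_neg σ e hx hn hnm with h | ⟨h, h'⟩
        · simp [h]
        · exact mul_nonneg (sub_nonneg.2 (hlam _ _ h)) h'

end BinaryRootedTree

/-! ### Partial sums of the spectral projections -/

section PartialSums

variable {N : ℕ} {ι : Type*}

/-- The entry `(i, j)` of the orthogonal projection `∑ vₙ vₙᵀ`, `n ∈ U`. -/
def projEntry (v : ι → EuclideanSpace ℝ (Fin N)) (U : Finset ι) (i j : Fin N) : ℝ :=
  ∑ n ∈ U, v n i * v n j

/-- `U` contains `one` and is closed under passing to larger indices. -/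
def IsUpClosed (ge : ι → ι → Prop) (one : ι) (U : Finset ι) : Prop :=
  one ∈ U ∧ ∀ n m, m ∈ U → ge n m → n ∈ U

/-- `A` is the class in `U` of each of its elements, where two entries are in the same class when
the projection onto the span of the `vₙ`, `n ∈ U`, is positive there. The empty set is allowed. -/
def IsBlock (v : ι → EuclideanSpace ℝ (Fin N)) (U : Finset ι) (A : Finset (Fin N)) : Prop :=
  ∀ i ∈ A, ∀ j, j ∈ A ↔ 0 < projEntry v U i j

/-- The set of entries where `y` is positive. -/
noncomputable def posSet (y : EuclideanSpace ℝ (Fin N)) : Finset (Fin N) := {i | 0 < y i}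

/-- The set of entries where `y` is negative. -/
noncomputable def negSet (y : EuclideanSpace ℝ (Fin N)) : Finset (Fin N) := {i | y i < 0}

/-- The set of entries where `y` does not vanish. -/
noncomputable def suppSet (y : EuclideanSpace ℝ (Fin N)) : Finset (Fin N) := {i | y i ≠ 0}

@[simp] theorem mem_posSet {y : EuclideanSpace ℝ (Fin N)} {i : Fin N} :
    i ∈ posSet y ↔ 0 < y i := by simp [posSet]

@[simp] theorem mem_negSet {y : EuclideanSpace ℝ (Fin N)} {i : Fin N} :
    i ∈ negSet y ↔ y i < 0 := by simp [negSet]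

@[simp] theorem mem_suppSet {y : EuclideanSpace ℝ (Fin N)} {i : Fin N} :
    i ∈ suppSet y ↔ y i ≠ 0 := by simp [suppSet]

theorem disjoint_posSet_negSet (y : EuclideanSpace ℝ (Fin N)) :
    Disjoint (posSet y) (negSet y) :=
  Finset.disjoint_left.2 fun _ h h' => lt_asymm (mem_posSet.1 h) (mem_negSet.1 h')

theorem posSet_subset_suppSet (y : EuclideanSpace ℝ (Fin N)) : posSet y ⊆ suppSet y :=
  fun _ h => mem_suppSet.2 (mem_posSet.1 h).ne'

theorem negSet_subset_suppSet (y : EuclideanSpace ℝ (Fin N)) : negSet y ⊆ suppSet y :=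
  fun _ h => mem_suppSet.2 (mem_negSet.1 h).ne

theorem projEntry_comm (v : ι → EuclideanSpace ℝ (Fin N)) (U : Finset ι) (i j : Fin N) :
    projEntry v U i j = projEntry v U j i :=
  Finset.sum_congr rfl fun _ _ => mul_comm _ _

theorem projEntry_insert [DecidableEq ι] (v : ι → EuclideanSpace ℝ (Fin N)) {U : Finset ι} {n : ι}
    (hn : n ∉ U) (i j : Fin N) :
    projEntry v (insert n U) i j = v n i * v n j + projEntry v U i j :=
  Finset.sum_insert hn

end PartialSums

namespace IsPartiallyOrderedSoulesBasis

variable {N : ℕ} {ι : Type*} [Fintype ι] {v : ι → EuclideanSpace ℝ (Fin N)} {ge : ι → ι → Prop}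
  {one : ι}

theorem sum_mul (h : IsPartiallyOrderedSoulesBasis v ge one) [DecidableEq ι] (n m : ι) :
    ∑ i, v n i * v m i = if n = m then 1 else 0 := by
  have := orthonormal_iff_ite.1 h.orthonormal n m
  rw [PiLp.inner_apply] at this
  simpa [mul_comm] using this

theorem projEntry_nonneg (h : IsPartiallyOrderedSoulesBasis v ge one) {U : Finset ι}
    (hU : IsUpClosed ge one U) (i j : Fin N) : 0 ≤ projEntry v U i j := by
  classical
  by_cases hij : i = j
  · subst hij
    exact Finset.sum_nonneg fun n _ => mul_self_nonneg _
  · have := h.offDiag_nonneg (fun n => if n ∈ U then 1 else 0) (fun n m hnm => by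
      by_cases hm : m ∈ U
      · simp [hm, hU.2 n m hm hnm]
      · simp only [hm, if_false]
        split_ifs <;> norm_num) i j hij
    simpa only [projEntry, Matrix.sum_apply, Matrix.smul_apply, Matrix.vecMulVec_apply,
      smul_eq_mul, ite_mul, one_mul, zero_mul, Finset.sum_ite_mem, Finset.univ_inter] using this

theorem sum_projEntry_mul (h : IsPartiallyOrderedSoulesBasis v ge one) [DecidableEq ι]
    (U : Finset ι) (n : ι) (i : Fin N) :
    ∑ j, projEntry v U i j * v n j = if n ∈ U then v n i else 0 := by
  simp only [projEntry, Finset.sum_mul]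
  rw [Finset.sum_comm]
  simp only [mul_assoc, ← Finset.mul_sum, h.sum_mul]
  simp

theorem sum_projEntry_mul_projEntry (h : IsPartiallyOrderedSoulesBasis v ge one)
    (U : Finset ι) (i j : Fin N) :
    ∑ l, projEntry v U i l * projEntry v U l j = projEntry v U i j := by
  classical
  have : ∀ l, projEntry v U i l * projEntry v U l j =
      ∑ n ∈ U, (projEntry v U i l * v n l) * v n j := fun l => by
    rw [projEntry, projEntry, Finset.mul_sum]
    simp only [mul_assoc]
  simp only [this]
  rw [Finset.sum_comm]
  simp only [← Finset.sum_mul, h.sum_projEntry_mul]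
  exact Finset.sum_congr rfl fun n hn => by rw [if_pos hn]

theorem projEntry_pos_trans (h : IsPartiallyOrderedSoulesBasis v ge one) {U : Finset ι}
    (hU : IsUpClosed ge one U) {i j k : Fin N} (hij : 0 < projEntry v U i j)
    (hjk : 0 < projEntry v U j k) : 0 < projEntry v U i k := by
  rw [← h.sum_projEntry_mul_projEntry]
  exact Finset.sum_pos'
    (fun l _ => mul_nonneg (h.projEntry_nonneg hU i l) (h.projEntry_nonneg hU l k))
    ⟨j, Finset.mem_univ _, mul_pos hij hjk⟩

/-- A vector fixed by the projection has constant ratio to `v₁` on each class. For a fixed vector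
`y` with ratios `tᵢ` to `x = v₁`, the weighted sum `∑ Pᵢⱼ xᵢ xⱼ (tᵢ - tⱼ)²` expands to
`2 (‖y‖² - ⟨y, P y⟩) = 0`. -/
theorem div_eq_div_of_projEntry_pos (h : IsPartiallyOrderedSoulesBasis v ge one) {U : Finset ι}
    (hU : IsUpClosed ge one U) {n : ι} (hn : n ∈ U) {i j : Fin N}
    (hij : 0 < projEntry v U i j) : v n i / v one i = v n j / v one j := by
  classical
  have hx := h.one_pos
  set t : Fin N → ℝ := fun i => v n i / v one i with ht
  have hy : ∀ i, v n i = t i * v one i := fun i => (div_mul_cancel₀ _ (hx i).ne').symm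
  set F : Fin N → Fin N → ℝ := fun i j =>
    projEntry v U i j * (v one i * v one j) * (t i - t j) ^ 2 with hF
  have hF0 : ∀ i j, 0 ≤ F i j := fun i j =>
    mul_nonneg (mul_nonneg (h.projEntry_nonneg hU i j) (mul_pos (hx i) (hx j)).le) (sq_nonneg _)
  have hone : ∀ i, ∑ j, projEntry v U i j * v one j = v one i := fun i => by
    rw [h.sum_projEntry_mul, if_pos hU.1]
  have hn' : ∀ i, ∑ j, projEntry v U i j * v n j = v n i := fun i => by
    rw [h.sum_projEntry_mul, if_pos hn]
  have hA : ∑ i, ∑ j, t i ^ 2 * v one i * (projEntry v U i j * v one j) = ∑ i, v n i ^ 2 := by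
    simp only [← Finset.mul_sum, hone]
    exact Finset.sum_congr rfl fun i _ => by rw [hy i]; ring
  have hB : ∑ i, ∑ j, t j ^ 2 * v one j * (projEntry v U j i * v one i) = ∑ i, v n i ^ 2 := by
    rw [Finset.sum_comm]
    exact hA
  have hC : ∑ i, ∑ j, v n i * (projEntry v U i j * v n j) = ∑ i, v n i ^ 2 := by
    simp only [← Finset.mul_sum, hn']
    exact Finset.sum_congr rfl fun i _ => by ring
  have hsum : ∑ i, ∑ j, F i j = 0 := by
    have : ∀ i j, F i j = t i ^ 2 * v one i * (projEntry v U i j * v one j) +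
        t j ^ 2 * v one j * (projEntry v U j i * v one i) -
        2 * (v n i * (projEntry v U i j * v n j)) := fun i j => by
      rw [hy i, hy j, projEntry_comm v U j i]
      simp only [hF]
      ring
    simp only [this, Finset.sum_sub_distrib, Finset.sum_add_distrib, ← Finset.mul_sum]
    simp only [← Finset.mul_sum] at hA hB hC
    rw [hA, hB, hC]
    ring
  have h1 := (Finset.sum_eq_zero_iff_of_nonneg fun i _ =>
    Finset.sum_nonneg fun j _ => hF0 i j).1 hsum i (Finset.mem_univ _)
  have h2 := (Finset.sum_eq_zero_iff_of_nonneg fun j _ => hF0 i j).1 h1 j (Finset.mem_univ _)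
  have h3 : projEntry v U i j * (v one i * v one j) ≠ 0 :=
    (mul_pos hij (mul_pos (hx i) (hx j))).ne'
  have h4 : (t i - t j) ^ 2 = 0 := (mul_eq_zero.1 h2).resolve_left h3
  exact sub_eq_zero.1 (pow_eq_zero_iff two_ne_zero |>.1 h4)

theorem pos_iff_div_pos (h : IsPartiallyOrderedSoulesBasis v ge one) (n : ι) (i : Fin N) :
    0 < v n i ↔ 0 < v n i / v one i := (div_pos_iff_of_pos_right (h.one_pos i)).symm

theorem neg_iff_div_neg (h : IsPartiallyOrderedSoulesBasis v ge one) (n : ι) (i : Fin N) :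
    v n i < 0 ↔ v n i / v one i < 0 := by
  rw [div_lt_iff₀ (h.one_pos i), zero_mul]

theorem ne_iff_div_ne (h : IsPartiallyOrderedSoulesBasis v ge one) (n : ι) (i : Fin N) :
    v n i ≠ 0 ↔ v n i / v one i ≠ 0 := by
  simp [(h.one_pos i).ne']

theorem posSet_nonempty (h : IsPartiallyOrderedSoulesBasis v ge one) {n : ι} (hn : n ≠ one) :
    (posSet (v n)).Nonempty := by
  classical
  by_contra hne
  have h0 : ∀ i, v n i ≤ 0 := fun i => not_lt.1 fun hi => hne ⟨i, mem_posSet.2 hi⟩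
  have h1 := h.sum_mul n one
  rw [if_neg hn, Finset.sum_eq_zero_iff_of_nonpos fun i _ =>
    mul_nonpos_of_nonpos_of_nonneg (h0 i) (h.one_pos i).le] at h1
  have h2 := h.sum_mul n n
  simp only [if_true] at h2
  rw [Finset.sum_eq_zero fun i hi => ?_] at h2
  · exact zero_ne_one h2
  · simp [(mul_eq_zero.1 (h1 i hi)).resolve_right (h.one_pos i).ne']

theorem negSet_nonempty (h : IsPartiallyOrderedSoulesBasis v ge one) {n : ι} (hn : n ≠ one) :
    (negSet (v n)).Nonempty := by
  classical
  by_contra hne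
  have h0 : ∀ i, 0 ≤ v n i := fun i => not_lt.1 fun hi => hne ⟨i, mem_negSet.2 hi⟩
  have h1 := h.sum_mul n one
  rw [if_neg hn, Finset.sum_eq_zero_iff_of_nonneg fun i _ =>
    mul_nonneg (h0 i) (h.one_pos i).le] at h1
  have h2 := h.sum_mul n n
  simp only [if_true] at h2
  rw [Finset.sum_eq_zero fun i hi => ?_] at h2
  · exact zero_ne_one h2
  · simp [(mul_eq_zero.1 (h1 i hi)).resolve_right (h.one_pos i).ne']

/-! ### Adding one vector splits one block in two -/

section Step

variable [DecidableEq ι] {U : Finset ι} {n : ι}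

theorem projEntry_insert_pos (h : IsPartiallyOrderedSoulesBasis v ge one)
    (hU : IsUpClosed ge one U) (hn : n ∉ U) {i j : Fin N} (hij : 0 < v n i * v n j) :
    0 < projEntry v (insert n U) i j := by
  rw [projEntry_insert v hn]
  exact add_pos_of_pos_of_nonneg hij (h.projEntry_nonneg hU i j)

theorem isBlock_posSet (h : IsPartiallyOrderedSoulesBasis v ge one) (hU : IsUpClosed ge one U)
    (hn : n ∉ U) (hnU : IsUpClosed ge one (insert n U)) :
    IsBlock v (insert n U) (posSet (v n)) := by
  intro i hi j
  rw [mem_posSet] at hi ⊢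
  refine ⟨fun hj => h.projEntry_insert_pos hU hn (mul_pos hi hj), fun hij => ?_⟩
  rw [h.pos_iff_div_pos] at hi ⊢
  rwa [← h.div_eq_div_of_projEntry_pos hnU (Finset.mem_insert_self _ _) hij]

theorem isBlock_negSet (h : IsPartiallyOrderedSoulesBasis v ge one) (hU : IsUpClosed ge one U)
    (hn : n ∉ U) (hnU : IsUpClosed ge one (insert n U)) :
    IsBlock v (insert n U) (negSet (v n)) := by
  intro i hi j
  rw [mem_negSet] at hi ⊢
  refine ⟨fun hj => h.projEntry_insert_pos hU hn (mul_pos_of_neg_of_neg hi hj), fun hij => ?_⟩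
  rw [h.neg_iff_div_neg] at hi ⊢
  rwa [← h.div_eq_div_of_projEntry_pos hnU (Finset.mem_insert_self _ _) hij]

theorem projEntry_pos_of_mul_neg (h : IsPartiallyOrderedSoulesBasis v ge one)
    (hn : n ∉ U) (hnU : IsUpClosed ge one (insert n U)) {i j : Fin N}
    (hij : v n i * v n j < 0) : 0 < projEntry v U i j := by
  have := h.projEntry_nonneg hnU i j
  rw [projEntry_insert v hn] at this
  linarith

/-- The support of `vₙ` is a block just before `vₙ` is added. -/
theorem isBlock_suppSet (h : IsPartiallyOrderedSoulesBasis v ge one) (hU : IsUpClosed ge one U)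
    (hn : n ∉ U) (hnU : IsUpClosed ge one (insert n U)) : IsBlock v U (suppSet (v n)) := by
  have hn1 : n ≠ one := fun h1 => hn (h1 ▸ hU.1)
  have hopp : ∀ {i j}, v n i * v n j < 0 → 0 < projEntry v U i j :=
    fun hij => h.projEntry_pos_of_mul_neg hn hnU hij
  obtain ⟨p, hp⟩ := h.posSet_nonempty hn1
  obtain ⟨q, hq⟩ := h.negSet_nonempty hn1
  rw [mem_posSet] at hp
  rw [mem_negSet] at hq
  intro i hi j
  rw [mem_suppSet] at hi ⊢
  constructor
  · intro hj
    -- Entries of equal sign are linked through an entry of the opposite sign.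
    rcases hi.lt_or_gt with hi | hi <;> rcases hj.lt_or_gt with hj | hj
    · exact h.projEntry_pos_trans hU (hopp (mul_neg_of_neg_of_pos hi hp))
        (hopp (mul_neg_of_pos_of_neg hp hj))
    · exact hopp (mul_neg_of_neg_of_pos hi hj)
    · exact hopp (mul_neg_of_pos_of_neg hi hj)
    · exact h.projEntry_pos_trans hU (hopp (mul_neg_of_pos_of_neg hi hq))
        (hopp (mul_neg_of_neg_of_pos hq hj))
  · intro hij hj
    have h1 : 0 < projEntry v (insert n U) i j := by
      rwa [projEntry_insert v hn, hj, mul_zero, zero_add]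
    have h2 := h.div_eq_div_of_projEntry_pos hnU (Finset.mem_insert_self _ _) h1
    rw [h.ne_iff_div_ne, h2, hj, zero_div] at hi
    exact hi rfl

end Step

theorem isUpClosed_singleton (h : IsPartiallyOrderedSoulesBasis v ge one) :
    IsUpClosed ge one {one} := by
  refine ⟨Finset.mem_singleton_self _, fun n m hm hnm => ?_⟩
  rw [Finset.mem_singleton] at hm ⊢
  exact h.ge_antisymm _ _ (hm ▸ hnm) (h.one_ge n)

theorem exists_isUpClosed_insert (h : IsPartiallyOrderedSoulesBasis v ge one) [DecidableEq ι]
    {n m : ι} (hnm : ¬ ge n m) :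
    ∃ U, IsUpClosed ge one U ∧ n ∉ U ∧ IsUpClosed ge one (insert n U) ∧ m ∈ U ∧
      ∀ k ∈ U, ge k n ∨ ge k m := by
  classical
  have h1 : n ≠ one := fun h1 => hnm (h1 ▸ h.one_ge m)
  refine ⟨({k | (ge k n ∨ ge k m) ∧ k ≠ n} : Finset ι), ⟨?_, ?_⟩, ?_, ⟨?_, ?_⟩, ?_, ?_⟩
  · simpa using ⟨.inl (h.one_ge n), h1.symm⟩
  · intro a b hb hab
    simp only [Finset.mem_filter, Finset.mem_univ, true_and] at hb ⊢
    refine ⟨hb.1.imp (h.ge_trans _ _ _ hab) (h.ge_trans _ _ _ hab), ?_⟩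
    rintro rfl
    rcases hb.1 with hb1 | hb1
    · exact hb.2 (h.ge_antisymm _ _ hb1 hab)
    · exact hnm (h.ge_trans _ _ _ hab hb1)
  · simp
  · simpa [h1.symm] using Or.inl (h.one_ge n)
  · intro a b hb hab
    simp only [Finset.mem_insert, Finset.mem_filter, Finset.mem_univ, true_and] at hb ⊢
    by_cases han : a = n
    · exact .inl han
    · rcases hb with rfl | hb
      · exact .inr ⟨.inl hab, han⟩
      · exact .inr ⟨hb.1.imp (h.ge_trans _ _ _ hab) (h.ge_trans _ _ _ hab), han⟩
  · simpa using ⟨.inr (h.ge_refl m), fun hm => hnm (hm ▸ h.ge_refl m)⟩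
  · intro k hk
    simp only [Finset.mem_filter, Finset.mem_univ, true_and] at hk
    exact hk.1

/-- The strict upper bounds of an index other than `one` form an upward closed set, which stays
upward closed when the index is added. -/
theorem exists_isUpClosed_insert_of_ne (h : IsPartiallyOrderedSoulesBasis v ge one)
    [DecidableEq ι] {n : ι} (hn : n ≠ one) :
    ∃ U, IsUpClosed ge one U ∧ n ∉ U ∧ IsUpClosed ge one (insert n U) ∧ ∀ k ∈ U, ge k n := by
  obtain ⟨U, h1, h2, h3, -, h4⟩ := h.exists_isUpClosed_insert
    fun hge : ge n one => hn (h.ge_antisymm _ _ hge (h.one_ge n))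
  exact ⟨U, h1, h2, h3, fun k hk => (h4 k hk).elim id
    fun hk1 => h.ge_antisymm _ _ hk1 (h.one_ge k) ▸ h.one_ge n⟩

/-- Distinct vectors other than `v₁` have distinct supports, so a non-leaf node determines
its vector. -/
theorem suppSet_injective (h : IsPartiallyOrderedSoulesBasis v ge one) {n m : ι} (hn : n ≠ one)
    (hm : m ≠ one) (hnm : suppSet (v n) = suppSet (v m)) : n = m := by
  classical
  -- If `vₙ` is added after `vₘ`, the support of `vₙ` is a block on which `vₘ` has one sign.
  have key : ∀ {n m : ι}, m ≠ one → suppSet (v n) = suppSet (v m) → ge n m := by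
    intro n m hm hnm
    by_contra hge
    obtain ⟨U, hU, hnU, hins, hmU, -⟩ := h.exists_isUpClosed_insert hge
    have hb := h.isBlock_suppSet hU hnU hins
    rw [hnm] at hb
    obtain ⟨p, hp⟩ := h.posSet_nonempty hm
    obtain ⟨q, hq⟩ := h.negSet_nonempty hm
    have hpq := (hb p (posSet_subset_suppSet _ hp) q).1 (negSet_subset_suppSet _ hq)
    have heq := h.div_eq_div_of_projEntry_pos hU hmU hpq
    rw [mem_posSet, h.pos_iff_div_pos] at hp
    rw [mem_negSet, h.neg_iff_div_neg] at hq
    linarith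
  exact h.ge_antisymm _ _ (key hm hnm) (key hn hnm.symm)

/-- A vector `vₙ` of constant strict sign on the positive set of `vₘ` precedes `vₘ`. Otherwise
`vₙ` is orthogonal to all vectors preceding `vₘ`, whose span contains the restriction of `v₁` to
that positive set. -/
theorem ge_of_posSet (h : IsPartiallyOrderedSoulesBasis v ge one) {n m : ι} (hm : m ≠ one)
    (hs : (∀ i ∈ posSet (v m), 0 < v n i) ∨ ∀ i ∈ posSet (v m), v n i < 0) : ge n m := by
  classical
  by_contra hge
  obtain ⟨U, hU, hmU, hins, hUm⟩ := h.exists_isUpClosed_insert_of_ne hm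
  have hn : n ∉ insert m U := fun hn => hge <| (Finset.mem_insert.1 hn).elim
    (fun hn => hn ▸ h.ge_refl m) (hUm n)
  have hb := h.isBlock_posSet hU hmU hins
  obtain ⟨p, hp⟩ := h.posSet_nonempty hm
  -- `vₙ` is annihilated by a projection whose row `p` is positive exactly on the positive set.
  have hsum := h.sum_projEntry_mul (insert m U) n p
  rw [if_neg hn] at hsum
  have h0 : ∀ j, j ∉ posSet (v m) → projEntry v (insert m U) p j = 0 := fun j hj =>
    le_antisymm (not_lt.1 fun hj' => hj ((hb p hp j).2 hj')) (h.projEntry_nonneg hins p j)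
  have hpp := (hb p hp p).1 hp
  rcases hs with hs | hs
  · refine (Finset.sum_pos' (fun j _ => ?_) ⟨p, Finset.mem_univ _, mul_pos hpp (hs p hp)⟩).ne' hsum
    by_cases hj : j ∈ posSet (v m)
    · exact mul_nonneg (h.projEntry_nonneg hins p j) (hs j hj).le
    · simp [h0 j hj]
  · refine (Finset.sum_neg' (fun j _ => ?_)
      ⟨p, Finset.mem_univ _, mul_neg_of_pos_of_neg hpp (hs p hp)⟩).ne hsum
    by_cases hj : j ∈ posSet (v m)
    · exact mul_nonpos_of_nonneg_of_nonpos (h.projEntry_nonneg hins p j) (hs j hj).le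
    · simp [h0 j hj]

/-- A block with at least two elements has to be split at some point, since the projection onto
the whole space is the identity; the first vector that changes it has it as its support. -/
theorem exists_eq_suppSet (h : IsPartiallyOrderedSoulesBasis v ge one) {U : Finset ι}
    (hU : IsUpClosed ge one U) {A : Finset (Fin N)} (hA : IsBlock v U A) {i j : Fin N}
    (hi : i ∈ A) (hj : j ∈ A) (hij : i ≠ j) : ∃ n, n ≠ one ∧ A = suppSet (v n) := by
  classical
  obtain ⟨W, ⟨hW, hWA⟩, hmax⟩ :=
    (Set.toFinite {U | IsUpClosed ge one U ∧ IsBlock v U A}).exists_maximal ⟨U, hU, hA⟩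
  have hne : Wᶜ.Nonempty := by
    rw [Finset.nonempty_iff_ne_empty, Ne, Finset.compl_eq_empty_iff]
    rintro rfl
    exact ((hWA i hi j).1 hj).ne' (h.orthonormal.sum_mul_eq_zero h.card_eq hij)
  -- An index outside `W` that is maximal for the order.
  obtain ⟨n, hnW, hmin⟩ := Finset.exists_min_image Wᶜ
    (fun n => ({k | ge k n} : Finset ι).card) hne
  rw [Finset.mem_compl] at hnW
  have hup : ∀ k, ge k n → k ∈ insert n W := by
    intro k hk
    by_contra hkW
    simp only [Finset.mem_insert, not_or] at hkW
    refine (hmin k (Finset.mem_compl.2 hkW.2)).not_gt (Finset.card_lt_card ?_)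
    refine Finset.ssubset_iff_subset_ne.2 ⟨fun a ha => ?_, fun heq => ?_⟩
    · simp only [Finset.mem_filter, Finset.mem_univ, true_and] at ha ⊢
      exact h.ge_trans _ _ _ ha hk
    · have : n ∈ ({a | ge a k} : Finset ι) := heq ▸ by simpa using h.ge_refl n
      exact hkW.1 (h.ge_antisymm _ _ hk (by simpa using this))
  have hins : IsUpClosed ge one (insert n W) := by
    refine ⟨Finset.mem_insert_of_mem hW.1, fun a b hb hab => ?_⟩
    rcases Finset.mem_insert.1 hb with rfl | hb
    · exact hup a hab
    · exact Finset.mem_insert_of_mem (hW.2 a b hb hab)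
  have hS := h.isBlock_suppSet hW hnW hins
  refine ⟨n, fun h1 => hnW (h1 ▸ hW.1), ?_⟩
  by_cases hd : ∃ k ∈ A, k ∈ suppSet (v n)
  · obtain ⟨k, hkA, hkS⟩ := hd
    ext l
    rw [hWA k hkA l, hS k hkS l]
  · refine absurd (hmax ⟨hins, fun k hk l => ?_⟩ (Finset.subset_insert n W)
      (Finset.mem_insert_self n W)) hnW
    have : v n k = 0 := by
      by_contra hk0
      exact hd ⟨k, hk, mem_suppSet.2 hk0⟩
    rw [projEntry_insert v hnW, this, zero_mul, zero_add]
    exact hWA k hk l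

end IsPartiallyOrderedSoulesBasis

/-! ### The tree of a partially ordered Soules basis -/

/-- Acyclicity together with the disjointness of the branches at each node makes directed
paths unique. -/
theorem IsDirectedPath.eq_of_child_unique {V : Type*} {Link : V → V → Prop}
    (hac : ∀ a b, Link a b → ¬ Relation.ReflTransGen Link b a)
    (hch : ∀ a p q k, Link a p → Link a q → Relation.ReflTransGen Link p k →
      Relation.ReflTransGen Link q k → p = q)
    {a b : V} {l l' : List V} (h : IsDirectedPath Link a b l) (h' : IsDirectedPath Link a b l') :
    l = l' := by
  have tail : ∀ {a c : V} {t : List V}, IsDirectedPath Link a b (a :: c :: t) →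
      Link a c ∧ IsDirectedPath Link c b (c :: t) := by
    rintro a c t ⟨-, h2, h3⟩
    rw [List.isChain_cons_cons] at h3
    exact ⟨h3.1, rfl, by simpa using h2, h3.2⟩
  induction l generalizing a l' with
  | nil => simp [IsDirectedPath] at h
  | cons a₁ t ih =>
    obtain rfl : a₁ = a := by simpa using h.1
    obtain ⟨t', rfl, -⟩ := isDirectedPath_iff.1 h'
    rcases t with _ | ⟨c, s⟩ <;> rcases t' with _ | ⟨c', s'⟩
    · rfl
    · obtain rfl : a₁ = b := by simpa using h.2.1
      exact absurd (tail h').2.reflTransGen (hac _ _ (tail h').1)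
    · obtain rfl : a₁ = b := by simpa using h'.2.1
      exact absurd (tail h).2.reflTransGen (hac _ _ (tail h).1)
    · obtain ⟨h1, h2⟩ := tail h
      obtain ⟨h1', h2'⟩ := tail h'
      obtain rfl := hch _ _ _ _ h1 h1' h2.reflTransGen h2'.reflTransGen
      rw [ih h2 h2']

/-- The support of each vector of the basis other than `v₁` is linked to the positive and to the
negative set of that vector. -/
def SplitLink {N : ℕ} {ι : Type*} (v : ι → EuclideanSpace ℝ (Fin N)) (one : ι)
    (A B : Finset (Fin N)) : Prop :=
  ∃ n, n ≠ one ∧ A = suppSet (v n) ∧ (B = posSet (v n) ∨ B = negSet (v n))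

/-- The nodes of the tree of a basis: the sets of entries obtained from the full set by repeatedly
passing from the support of a vector to its positive or its negative set. -/
abbrev SplitNode {N : ℕ} {ι : Type*} (v : ι → EuclideanSpace ℝ (Fin N)) (one : ι) : Type :=
  {A : Finset (Fin N) // Relation.ReflTransGen (SplitLink v one) Finset.univ A}

theorem SplitLink.subset {N : ℕ} {ι : Type*} {v : ι → EuclideanSpace ℝ (Fin N)} {one : ι}
    {A B : Finset (Fin N)} (h : SplitLink v one A B) : B ⊆ A := by
  obtain ⟨n, -, rfl, rfl | rfl⟩ := h
  exacts [posSet_subset_suppSet _, negSet_subset_suppSet _]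

theorem SplitNode.subset {N : ℕ} {ι : Type*} {v : ι → EuclideanSpace ℝ (Fin N)} {one : ι}
    {A B : SplitNode v one}
    (h : Relation.ReflTransGen (fun A B : SplitNode v one => SplitLink v one A.1 B.1) A B) :
    B.1 ⊆ A.1 := by
  induction h with
  | refl => exact subset_rfl
  | tail _ h ih => exact h.subset.trans ih

namespace IsPartiallyOrderedSoulesBasis

variable {N : ℕ} {ι : Type*} [Fintype ι] {v : ι → EuclideanSpace ℝ (Fin N)} {ge : ι → ι → Prop}
  {one : ι}

theorem ssubset_of_splitLink (h : IsPartiallyOrderedSoulesBasis v ge one) {A B : Finset (Fin N)}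
    (hAB : SplitLink v one A B) : B ⊂ A := by
  refine Finset.ssubset_iff_subset_ne.2 ⟨hAB.subset, ?_⟩
  obtain ⟨n, hn, rfl, rfl | rfl⟩ := hAB
  · obtain ⟨i, hi⟩ := h.negSet_nonempty hn
    exact fun heq => Finset.disjoint_left.1 (disjoint_posSet_negSet (v n))
      (heq ▸ negSet_subset_suppSet _ hi) hi
  · obtain ⟨i, hi⟩ := h.posSet_nonempty hn
    exact fun heq => Finset.disjoint_left.1 (disjoint_posSet_negSet (v n)) hi
      (heq ▸ posSet_subset_suppSet _ hi)

theorem splitNode_nonempty (h : IsPartiallyOrderedSoulesBasis v ge one) (A : SplitNode v one) :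
    A.1.Nonempty := by
  obtain ⟨A, hA⟩ := A
  rcases hA.cases_tail with rfl | ⟨B, -, n, hn, -, rfl | rfl⟩
  · have : 0 < N := h.card_eq ▸ Fintype.card_pos_iff.2 ⟨one⟩
    exact ⟨⟨0, this⟩, Finset.mem_univ _⟩
  · exact h.posSet_nonempty hn
  · exact h.negSet_nonempty hn

theorem exists_isBlock (h : IsPartiallyOrderedSoulesBasis v ge one) (A : SplitNode v one) :
    ∃ U, IsUpClosed ge one U ∧ IsBlock v U A.1 := by
  classical
  obtain ⟨A, hA⟩ := A
  rcases hA.cases_tail with rfl | ⟨B, -, n, hn, -, hA⟩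
  · refine ⟨{one}, h.isUpClosed_singleton, fun i _ j => ?_⟩
    simpa [projEntry] using mul_pos (h.one_pos i) (h.one_pos j)
  · obtain ⟨U, hU, hnU, hins, -⟩ := h.exists_isUpClosed_insert_of_ne hn
    refine ⟨insert n U, hins, ?_⟩
    rcases hA with rfl | rfl
    · exact h.isBlock_posSet hU hnU hins
    · exact h.isBlock_negSet hU hnU hins

theorem eq_suppSet_or_eq_singleton (h : IsPartiallyOrderedSoulesBasis v ge one)
    (A : SplitNode v one) : (∃ n, n ≠ one ∧ A.1 = suppSet (v n)) ∨ ∃ i, A.1 = {i} := by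
  rcases (h.splitNode_nonempty A).exists_eq_singleton_or_nontrivial with hA | ⟨i, hi, j, hj, hij⟩
  · exact .inr hA
  · obtain ⟨U, hU, hb⟩ := h.exists_isBlock A
    exact .inl (h.exists_eq_suppSet hU hb hi hj hij)

/-- Descending from a node towards a given element ends at the singleton of that element. -/
theorem exists_singleton_of_mem (h : IsPartiallyOrderedSoulesBasis v ge one) (A : SplitNode v one)
    {i : Fin N} (hi : i ∈ A.1) : ∃ B : SplitNode v one, B.1 = {i} ∧
      Relation.ReflTransGen (fun A B : SplitNode v one => SplitLink v one A.1 B.1) A B := by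
  induction hc : A.1.card using Nat.strong_induction_on generalizing A with
  | _ c ih =>
    subst hc
    rcases h.eq_suppSet_or_eq_singleton A with ⟨n, hn, hA⟩ | ⟨k, hk⟩
    · have step : ∀ B, SplitLink v one A.1 B → i ∈ B → ∃ B : SplitNode v one, B.1 = {i} ∧
          Relation.ReflTransGen (fun A B : SplitNode v one => SplitLink v one A.1 B.1) A B := by
        intro B hAB hiB
        obtain ⟨C, hC, hBC⟩ := ih _ (Finset.card_lt_card (h.ssubset_of_splitLink hAB))
          ⟨B, A.2.tail hAB⟩ hiB rfl
        exact ⟨C, hC, .head hAB hBC⟩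
      rw [hA, mem_suppSet] at hi
      rcases hi.lt_or_gt with hi | hi
      · exact step _ ⟨n, hn, hA, .inr rfl⟩ (mem_negSet.2 hi)
      · exact step _ ⟨n, hn, hA, .inl rfl⟩ (mem_posSet.2 hi)
    · rw [hk, Finset.mem_singleton] at hi
      exact ⟨A, by rw [hk, hi], .refl⟩

theorem splitLink_iff (h : IsPartiallyOrderedSoulesBasis v ge one) {n : ι} (hn : n ≠ one)
    {A : Finset (Fin N)} (hA : A = suppSet (v n)) (B : Finset (Fin N)) :
    SplitLink v one A B ↔ B = posSet (v n) ∨ B = negSet (v n) := by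
  constructor
  · rintro ⟨m, hm, hAm, hB⟩
    rwa [h.suppSet_injective hn hm (hA.symm.trans hAm)]
  · exact fun hB => ⟨n, hn, hA, hB⟩

theorem posSet_ne_negSet (h : IsPartiallyOrderedSoulesBasis v ge one) {n : ι} (hn : n ≠ one) :
    posSet (v n) ≠ negSet (v n) := by
  obtain ⟨i, hi⟩ := h.posSet_nonempty hn
  exact fun heq => Finset.disjoint_left.1 (disjoint_posSet_negSet (v n)) hi (heq ▸ hi)

/-- The binary rooted tree of a partially ordered Soules basis. -/
def splitTree (h : IsPartiallyOrderedSoulesBasis v ge one) :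
    BinaryRootedTree (SplitNode v one) where
  Link A B := SplitLink v one A.1 B.1
  root := ⟨Finset.univ, .refl⟩
  loopless A hA := (h.ssubset_of_splitLink hA).ne rfl
  binary A := by
    by_cases hA : ∃ n, n ≠ one ∧ A.1 = suppSet (v n)
    · obtain ⟨n, hn, hA⟩ := hA
      refine .inr ⟨⟨posSet (v n), A.2.tail ⟨n, hn, hA, .inl rfl⟩⟩,
        ⟨negSet (v n), A.2.tail ⟨n, hn, hA, .inr rfl⟩⟩, ?_, fun B => ?_⟩
      · exact fun heq => h.posSet_ne_negSet hn (congrArg Subtype.val heq)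
      · rw [h.splitLink_iff hn hA, Subtype.ext_iff, Subtype.ext_iff]
    · exact .inl fun B ⟨n, hn, hAn, _⟩ => hA ⟨n, hn, hAn⟩
  rooted := by
    rintro ⟨A, hA⟩
    induction hA with
    | refl => exact ⟨_, isDirectedPath_singleton _ _⟩
    | tail _ hBC ih =>
      obtain ⟨l, hl⟩ := ih
      exact ⟨_, hl.concat hBC⟩
  path_unique A B l l' := by
    refine IsDirectedPath.eq_of_child_unique (fun A B hAB hBA => ?_) fun A P Q K hP hQ hPK hQK => ?_
    · exact (h.ssubset_of_splitLink hAB).not_subset (SplitNode.subset hBA)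
    · obtain ⟨n, hn, hA, hPn⟩ := hP
      obtain ⟨i, hi⟩ := h.splitNode_nonempty K
      have hiP := SplitNode.subset hPK hi
      have hiQ := SplitNode.subset hQK hi
      have hd : i ∈ posSet (v n) → i ∉ negSet (v n) := fun hi =>
        Finset.disjoint_left.1 (disjoint_posSet_negSet (v n)) hi
      refine Subtype.ext ?_
      rcases hPn with hPn | hPn <;> rcases (h.splitLink_iff hn hA Q.1).1 hQ with hQn | hQn
      · rw [hPn, hQn]
      · exact absurd (hQn ▸ hiQ) (hd (hPn ▸ hiP))
      · exact absurd (hPn ▸ hiP) (hd (hQn ▸ hiQ))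
      · rw [hPn, hQn]

theorem isLeaf_splitTree_iff (h : IsPartiallyOrderedSoulesBasis v ge one) (A : SplitNode v one) :
    h.splitTree.IsLeaf A ↔ ∃ i, A.1 = {i} := by
  constructor
  · intro hA
    refine (h.eq_suppSet_or_eq_singleton A).resolve_left ?_
    rintro ⟨n, hn, hAn⟩
    have hl : SplitLink v one A.1 (posSet (v n)) := ⟨n, hn, hAn, .inl rfl⟩
    exact hA ⟨_, A.2.tail hl⟩ hl
  · rintro ⟨i, hi⟩ B hB
    have hss : B.1 ⊂ A.1 := h.ssubset_of_splitLink hB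
    rw [hi, Finset.ssubset_singleton_iff] at hss
    exact (h.splitNode_nonempty B).ne_empty hss

theorem exists_suppSet_of_not_isLeaf (h : IsPartiallyOrderedSoulesBasis v ge one)
    (A : h.splitTree.NonLeaf) : ∃ n, n ≠ one ∧ A.1.1 = suppSet (v n) :=
  (h.eq_suppSet_or_eq_singleton A.1).resolve_right
    fun hA => A.2 ((h.isLeaf_splitTree_iff A.1).2 hA)

/-- The index of the basis vector whose support is a given non-leaf node. -/
noncomputable def nodeIndex (h : IsPartiallyOrderedSoulesBasis v ge one)
    (A : h.splitTree.NonLeaf) : ι :=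
  (h.exists_suppSet_of_not_isLeaf A).choose

theorem nodeIndex_ne (h : IsPartiallyOrderedSoulesBasis v ge one) (A : h.splitTree.NonLeaf) :
    h.nodeIndex A ≠ one :=
  (h.exists_suppSet_of_not_isLeaf A).choose_spec.1

theorem eq_suppSet_nodeIndex (h : IsPartiallyOrderedSoulesBasis v ge one)
    (A : h.splitTree.NonLeaf) : A.1.1 = suppSet (v (h.nodeIndex A)) :=
  (h.exists_suppSet_of_not_isLeaf A).choose_spec.2

/-- The child of positive sign is the positive set of the vector. -/
noncomputable def splitSigns (h : IsPartiallyOrderedSoulesBasis v ge one) :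
    h.splitTree.ChildSigns where
  pos A := ⟨posSet (v (h.nodeIndex A)),
    A.1.2.tail ⟨_, h.nodeIndex_ne A, h.eq_suppSet_nodeIndex A, .inl rfl⟩⟩
  neg A := ⟨negSet (v (h.nodeIndex A)),
    A.1.2.tail ⟨_, h.nodeIndex_ne A, h.eq_suppSet_nodeIndex A, .inr rfl⟩⟩
  pos_ne_neg A heq := h.posSet_ne_negSet (h.nodeIndex_ne A) (congrArg Subtype.val heq)
  link_iff A B := by
    rw [Subtype.ext_iff, Subtype.ext_iff]
    exact h.splitLink_iff (h.nodeIndex_ne A) (h.eq_suppSet_nodeIndex A) B.1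

theorem exists_leaf_eq_singleton (h : IsPartiallyOrderedSoulesBasis v ge one) (i : Fin N) :
    ∃ A : h.splitTree.Leaf, A.1.1 = {i} := by
  obtain ⟨B, hB, -⟩ := h.exists_singleton_of_mem ⟨Finset.univ, .refl⟩ (Finset.mem_univ i)
  exact ⟨⟨B, (h.isLeaf_splitTree_iff B).2 ⟨i, hB⟩⟩, hB⟩

/-- The leaf nodes are the singletons. -/
noncomputable def leafEquiv (h : IsPartiallyOrderedSoulesBasis v ge one) :
    h.splitTree.Leaf ≃ Fin N :=
  (Equiv.ofBijective (fun i => (h.exists_leaf_eq_singleton i).choose) (by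
    have hs := fun i => (h.exists_leaf_eq_singleton i).choose_spec
    refine ⟨fun i j hij => ?_, fun A => ?_⟩
    · have := hs i
      rw [show (h.exists_leaf_eq_singleton i).choose = _ from hij, hs j] at this
      exact (Finset.singleton_injective this).symm
    · obtain ⟨i, hi⟩ := (h.isLeaf_splitTree_iff A.1).1 A.2
      exact ⟨i, Subtype.ext (Subtype.ext ((hs i).trans hi.symm))⟩)).symm

theorem leafEquiv_symm (h : IsPartiallyOrderedSoulesBasis v ge one) (i : Fin N) :
    (h.leafEquiv.symm i).1.1 = {i} :=
  (h.exists_leaf_eq_singleton i).choose_spec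

theorem ge_leafEquiv_symm_iff (h : IsPartiallyOrderedSoulesBasis v ge one) (A : SplitNode v one)
    (i : Fin N) : h.splitTree.Ge A (h.leafEquiv.symm i) ↔ i ∈ A.1 := by
  rw [BinaryRootedTree.ge_iff]
  constructor
  · intro hA
    have := SplitNode.subset hA
    rwa [h.leafEquiv_symm, Finset.singleton_subset_iff] at this
  · intro hi
    obtain ⟨B, hB, hAB⟩ := h.exists_singleton_of_mem A hi
    have : B = h.leafEquiv.symm i := Subtype.ext (hB.trans (h.leafEquiv_symm i).symm)
    exact this ▸ hAB

theorem leafPos_splitSigns (h : IsPartiallyOrderedSoulesBasis v ge one)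
    (A : h.splitTree.NonLeaf) :
    BinaryRootedTree.leafPos h.splitSigns h.leafEquiv A = posSet (v (h.nodeIndex A)) :=
  Set.ext fun i => h.ge_leafEquiv_symm_iff _ i

theorem leafNeg_splitSigns (h : IsPartiallyOrderedSoulesBasis v ge one)
    (A : h.splitTree.NonLeaf) :
    BinaryRootedTree.leafNeg h.splitSigns h.leafEquiv A = negSet (v (h.nodeIndex A)) :=
  Set.ext fun i => h.ge_leafEquiv_symm_iff _ i

/-- The positive and the negative set of `vₙ` are blocks once `vₙ` has been added, so `vₙ` has
constant ratio to `v₁` on each of them. -/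
theorem exists_eq_mul_signStep (h : IsPartiallyOrderedSoulesBasis v ge one) {n : ι}
    (hn : n ≠ one) : ∃ a b, 0 < a ∧
      ∀ i, v n i = v one i * signStep (posSet (v n) : Set (Fin N)) (negSet (v n)) a b i := by
  classical
  obtain ⟨U, hU, hnU, hins, -⟩ := h.exists_isUpClosed_insert_of_ne hn
  have hratio : ∀ {i j}, 0 < projEntry v (insert n U) i j → v n i / v one i = v n j / v one j :=
    fun hij => h.div_eq_div_of_projEntry_pos hins (Finset.mem_insert_self _ _) hij
  obtain ⟨p, hp⟩ := h.posSet_nonempty hn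
  obtain ⟨q, hq⟩ := h.negSet_nonempty hn
  refine ⟨v n p / v one p, -(v n q / v one q), div_pos (mem_posSet.1 hp) (h.one_pos p),
    fun i => ?_⟩
  have hx := (h.one_pos i).ne'
  have hdisj := Finset.disjoint_coe.2 (disjoint_posSet_negSet (v n))
  rcases lt_trichotomy (v n i) 0 with hi | hi | hi
  · rw [signStep_of_mem_right hdisj (by simpa using hi), neg_neg,
      hratio ((h.isBlock_negSet hU hnU hins q hq i).1 (mem_negSet.2 hi)), mul_div_cancel₀ _ hx]
  · rw [signStep_of_notMem (by simp [hi]), hi, mul_zero]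
  · rw [signStep_of_mem_left (by simpa using hi),
      hratio ((h.isBlock_posSet hU hnU hins p hp i).1 (mem_posSet.2 hi)), mul_div_cancel₀ _ hx]

theorem eq_soulesVector (h : IsPartiallyOrderedSoulesBasis v ge one) (A : h.splitTree.NonLeaf) :
    v (h.nodeIndex A) =
      BinaryRootedTree.soulesVector h.splitSigns h.leafEquiv (v one) (some A) := by
  classical
  have hn := h.nodeIndex_ne A
  obtain ⟨a, b, ha, hy⟩ := h.exists_eq_mul_signStep hn
  have h1 := h.sum_mul one (h.nodeIndex A)
  have h2 := h.sum_mul (h.nodeIndex A) (h.nodeIndex A)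
  rw [if_neg hn.symm] at h1
  simp only [if_true, ← sq] at h2
  obtain ⟨ha', hb'⟩ := (signStep_orthonormal_iff h.one_pos (by simpa using h.posSet_nonempty hn)
    (by simpa using h.negSet_nonempty hn)
    (Finset.disjoint_coe.2 (disjoint_posSet_negSet (v (h.nodeIndex A)))) ha hy).1 ⟨h1, h2⟩
  ext i
  rw [BinaryRootedTree.soulesVector_some_apply, h.leafPos_splitSigns, h.leafNeg_splitSigns,
    ← ha', ← hb']
  exact hy i

theorem nodeIndex_injective (h : IsPartiallyOrderedSoulesBasis v ge one) :
    Function.Injective h.nodeIndex := fun A B hAB =>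
  Subtype.ext (Subtype.ext (by rw [h.eq_suppSet_nodeIndex, hAB, ← h.eq_suppSet_nodeIndex]))

/-- The positive vector corresponds to the extra element, every other vector to the node that is
its support. -/
noncomputable def indexEquiv (h : IsPartiallyOrderedSoulesBasis v ge one) :
    Option h.splitTree.NonLeaf ≃ ι :=
  Equiv.ofBijective (fun k => k.elim one h.nodeIndex) (by
    rw [Fintype.bijective_iff_injective_and_card]
    refine ⟨?_, (BinaryRootedTree.card_option_nonLeaf h.splitSigns h.leafEquiv).trans
      h.card_eq.symm⟩
    rintro (_ | A) (_ | B) hAB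
    · rfl
    · exact absurd hAB.symm (h.nodeIndex_ne B)
    · exact absurd hAB (h.nodeIndex_ne A)
    · exact congrArg some (h.nodeIndex_injective hAB))

/-- If the node of `vₙ` is above the node of `vₘ`, the support of `vₘ` lies on one sign side
of `vₙ`, which forces `vₙ` to precede `vₘ`. -/
theorem ge_nodeIndex (h : IsPartiallyOrderedSoulesBasis v ge one) {A B : h.splitTree.NonLeaf}
    (hAB : h.splitTree.Ge A.1 B.1) : ge (h.nodeIndex A) (h.nodeIndex B) := by
  by_cases heq : A = B
  · rw [heq]
    exact h.ge_refl _
  obtain ⟨C, hAC, hCB⟩ := hAB.exists_link fun h' => heq (Subtype.ext h')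
  have hsub : posSet (v (h.nodeIndex B)) ⊆ C.1 := (posSet_subset_suppSet _).trans
    (h.eq_suppSet_nodeIndex B ▸ SplitNode.subset ((BinaryRootedTree.ge_iff _).1 hCB))
  refine h.ge_of_posSet (h.nodeIndex_ne B) ?_
  rcases (h.splitSigns.link_iff A C).1 hAC with rfl | rfl
  · exact .inl fun i hi => mem_posSet.1 (hsub hi)
  · exact .inr fun i hi => mem_negSet.1 (hsub hi)

end IsPartiallyOrderedSoulesBasis

theorem proposition1 (N : ℕ) :
    (∀ (V : Type*) [Finite V] (T : BinaryRootedTree V) (σ : T.ChildSigns) (e : T.Leaf ≃ Fin N)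
        (x : EuclideanSpace ℝ (Fin N)), (∀ i, 0 < x i) →
      IsPartiallyOrderedSoulesBasis (BinaryRootedTree.soulesVector σ e x) T.SoulesGe none) ∧
    (∀ (ι : Type*) [Fintype ι] (v : ι → EuclideanSpace ℝ (Fin N)) (ge : ι → ι → Prop) (one : ι),
      IsPartiallyOrderedSoulesBasis v ge one →
      ∃ (V : Type) (_ : Finite V) (T : BinaryRootedTree V) (σ : T.ChildSigns)
        (e : T.Leaf ≃ Fin N) (x : EuclideanSpace ℝ (Fin N)) (f : Option T.NonLeaf ≃ ι),
        (∀ i, 0 < x i) ∧ f none = one ∧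
        (∀ k, v (f k) = BinaryRootedTree.soulesVector σ e x k) ∧
        (∀ k l, T.SoulesGe k l → ge (f k) (f l))) := by
  refine ⟨fun V _ T σ e x hx =>
    BinaryRootedTree.isPartiallyOrderedSoulesBasis_soulesVector σ e hx, fun ι _ v ge one h => ?_⟩
  refine ⟨SplitNode v one, inferInstance, h.splitTree, h.splitSigns, h.leafEquiv, v one,
    h.indexEquiv, h.one_pos, rfl, ?_, ?_⟩
  · rintro (_ | A)
    · change v one = ‖v one‖⁻¹ • v one
      rw [h.orthonormal.1, inv_one, one_smul]
    · exact h.eq_soulesVector A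
  · rintro (_ | A) (_ | B) hAB
    · exact h.ge_refl one
    · exact h.one_ge _
    · exact hAB.elim
    · exact h.ge_nodeIndex hAB
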